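/- A graph is a 1-dimensional cube complex (loops and multiple edges are allowed); a leaf of a graph is a vertex of valency 1, and a graph is leafless if it has no leaves. A square complex is a cube complex of dimension at most 2. A map of square complexes is combinatorial if it maps each cell isomorphically onto a cell; a combinatorial map is a local isometry if for every vertex the induced map on links is injective and has as image an induced subcomplex. Let $Y$ be a square complex. A product structure is a local isometry $\iota:\Delta_1\times\Delta_2\to Y$, where $\Delta_1,\Delta_2$ are connected graphs, each with at least one edge, such that for some vertices $v_i\in\Delta_i$ the map $\iota$ restricts to isomorphisms of $\Delta_1\times\{v_2\}$ and of $\{v_1\}\times\Delta_2$ onto their images. The image of a product structure is a product subcomplex; it is a standard product subcomplex if $\iota$ can be chosen with $\Delta_1$ and $\Delta_2$ leafless, and it is maximal if it is maximal with respect to inclusion among the standard product subcomplexes of $Y$. Let $\Gamma$ be a connected graph, and let $UD_2(\Gamma)$ be its unordered discrete 2-configuration space, i.e. the square complex whose cells are the unordered pairs $\{\sigma_1,\sigma_2\}$ of disjoint closed cells (vertices or edges) of $\Gamma$. For disjoint connected subgraphs $\Gamma_1,\Gamma_2\subset\Gamma$, each with at least one edge, let $\Gamma_1\boxtimes\Gamma_2\subset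 UD_2(\Gamma)$ be the subcomplex of all cells $\{\sigma_1,\sigma_2\}$ with $\sigma_1$ a cell of $\Gamma_1$ and $\sigma_2$ a cell of $\Gamma_2$. **Proposition.** 1. A subcomplex $K\subset UD_2(\Gamma)$ is a product subcomplex if and only if $K=\Gamma_1\boxtimes\Gamma_2$ for some disjoint connected subgraphs $\Gamma_1,\Gamma_2$ of $\Gamma$, each with at least one edge; and $K$ is a standard product subcomplex if and only if $K=\Gamma_1\boxtimes\Gamma_2$ for some such $\Gamma_1,\Gamma_2$ that are leafless. Moreover, for such $\Gamma_1,\Gamma_2$, the subcomplex $\Gamma_1\boxtimes\Gamma_2$ is standard if and only if $\Gamma_1$ and $\Gamma_2$ are leafless. 2. Every product subcomplex of $UD_2(\Gamma)$, in particular every standard one, is embedded: every product structure $\Delta_1\times\Delta_2\to UD_2(\Gamma)$ is injective. 3. Let $(\Gamma_1,\Gamma_2)$ and $(\Lambda_1,\Lambda_2)$ be two pairs of disjoint connected subgraphs of $\Gamma$, each subgraph having at least one edge. Then $\Gamma_1\boxtimes\Gamma_2\subset\Lambda_1\boxtimes\Lambda_2$ if and only if either $\Gamma_1\subset\Lambda_1$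 and $\Gamma_2\subset\Lambda_2$, or $\Gamma_1\subset\Lambda_2$ and $\Gamma_2\subset\Lambda_1$. Likewise $\Gamma_1\boxtimes\Gamma_2=\Lambda_1\boxtimes\Lambda_2$ if and only if the two pairs agree up to swapping. 4. Let $\Gamma_1,\Gamma_2$ be disjoint connected subgraphs of $\Gamma$, each with at least one edge. Then $\Gamma_1\boxtimes\Gamma_2$ is a maximal product subcomplex if and only if it is a standard product subcomplex and there is no pair of disjoint connected leafless subgraphs $\Gamma_1',\Gamma_2'$ of $\Gamma$ such that $\Gamma_1\subset\Gamma_1'$ and $\Gamma_2\subset\Gamma_2'$ with at least one of the inclusions proper. The same equivalence holds if $\Gamma_1'$ and $\Gamma_2'$ are allowed to be disconnected, provided that each of their connected components contains an edge. -/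

import Mathlib

universe u v

/-- A graph, i.e. a `1`-dimensional cube complex (loops and multiple edges allowed, any
cardinality), given by its vertices `V` and its oriented edges (darts) `D`. Reversal of orientation
is a fixed-point free involution whose orbits are the edges; a dart `d` is also the half-edge of
its edge at the vertex `src d`. -/
structure SerreGraph where
  V : Type u
  D : Type u
  src : D → V
  rev : D → D
  rev_rev : ∀ d, rev (rev d) = d
  rev_ne : ∀ d, rev d ≠ d

namespace SerreGraph

/-- Terminal vertex of a dart. -/
def tgt (G : SerreGraph.{u}) (d : G.D) : G.V := G.src (G.rev d)

/-- Two vertices are joined by an edge. -/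
def Adj (G : SerreGraph.{u}) (a b : G.V) : Prop := ∃ d : G.D, G.src d = a ∧ G.tgt d = b

/-- Nonempty, and any two vertices are joined by an edge path. -/
def Connected (G : SerreGraph.{u}) : Prop :=
  Nonempty G.V ∧ ∀ a b : G.V, Relation.ReflTransGen G.Adj a b

/-- The graph contains at least one edge. -/
def IsNontrivial (G : SerreGraph.{u}) : Prop := Nonempty G.D

/-- A leaf is a vertex of valency `1`: exactly one half-edge is incident to it
(a loop contributes two half-edges). -/
def IsLeaf (G : SerreGraph.{u}) (x : G.V) : Prop := ∃! d : G.D, G.src d = x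

/-- The graph has no leaves. -/
def Leafless (G : SerreGraph.{u}) : Prop := ∀ x : G.V, ¬ G.IsLeaf x

/-- Every vertex is incident to an edge, i.e. every connected component contains an edge. -/
def NoIsolatedVertex (G : SerreGraph.{u}) : Prop := ∀ x : G.V, ∃ d : G.D, G.src d = x

/-- Subgraphs (subcomplexes) of a graph. -/
@[ext]
structure Subgraph (G : SerreGraph.{u}) where
  verts : Set G.V
  darts : Set G.D
  src_mem : ∀ d ∈ darts, G.src d ∈ verts
  rev_mem : ∀ d ∈ darts, G.rev d ∈ darts

namespace Subgraph

/-- Inclusion of subgraphs. -/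
instance (G : SerreGraph.{u}) : PartialOrder G.Subgraph where
  le H K := H.verts ⊆ K.verts ∧ H.darts ⊆ K.darts
  le_refl _ := ⟨subset_rfl, subset_rfl⟩
  le_trans _ _ _ h k := ⟨h.1.trans k.1, h.2.trans k.2⟩
  le_antisymm _ _ h k := Subgraph.ext (h.1.antisymm k.1) (h.2.antisymm k.2)

/-- A subgraph as a graph in its own right. -/
def coe {G : SerreGraph.{u}} (H : G.Subgraph) : SerreGraph.{u} where
  V := H.verts
  D := H.darts
  src d := ⟨G.src d, H.src_mem d d.2⟩
  rev d := ⟨G.rev d, H.rev_mem d d.2⟩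
  rev_rev d := Subtype.ext (G.rev_rev d)
  rev_ne d h := G.rev_ne d (congrArg Subtype.val h)

/-- Two subgraphs are disjoint if they have no common vertex (hence no common edge). -/
def IsDisjoint {G : SerreGraph.{u}} (H K : G.Subgraph) : Prop := Disjoint H.verts K.verts

end Subgraph

end SerreGraph

/-- A square complex (cube complex of dimension at most `2`), glued from vertices, edges and unit
squares. The `1`-skeleton is a graph. An element `q : Q` is a square together with a corner of it
and an ordering of the two half-edges of the square at this corner, that is, one of the eight
identifications of the square with `[0,1]²`; so the squares are the orbits of a free action of the
symmetry group of `[0,1]²`, which is generated by the reflection `swap` in the diagonal and the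
reflection `flip` in the first coordinate. The first side of `q` at its corner, oriented away from
the corner, is `side q`, and the second side is `side (swap q)`. -/
structure SquareComplex extends SerreGraph.{u} where
  Q : Type u
  side : Q → D
  swap : Q → Q
  flip : Q → Q
  swap_swap : ∀ q, swap (swap q) = q
  flip_flip : ∀ q, flip (flip q) = q
  flip_comm : ∀ q, flip (swap (flip (swap q))) = swap (flip (swap (flip q)))
  swap_ne : ∀ q, swap q ≠ q
  rot_ne : ∀ q, flip (swap (flip (swap q))) ≠ q
  src_side_swap : ∀ q, src (side (swap q)) = src (side q)
  side_flip : ∀ q, side (flip q) = rev (side q)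

namespace SquareComplex

/-- Subcomplexes of a square complex. -/
@[ext]
structure Subcomplex (Y : SquareComplex.{u}) where
  verts : Set Y.V
  darts : Set Y.D
  squares : Set Y.Q
  src_mem : ∀ d ∈ darts, Y.src d ∈ verts
  rev_mem : ∀ d ∈ darts, Y.rev d ∈ darts
  side_mem : ∀ q ∈ squares, Y.side q ∈ darts
  swap_mem : ∀ q ∈ squares, Y.swap q ∈ squares
  flip_mem : ∀ q ∈ squares, Y.flip q ∈ squares

/-- Inclusion of subcomplexes. -/
instance (Y : SquareComplex.{u}) : PartialOrder Y.Subcomplex where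
  le K L := K.verts ⊆ L.verts ∧ K.darts ⊆ L.darts ∧ K.squares ⊆ L.squares
  le_refl _ := ⟨subset_rfl, subset_rfl, subset_rfl⟩
  le_trans _ _ _ h k := ⟨h.1.trans k.1, h.2.1.trans k.2.1, h.2.2.trans k.2.2⟩
  le_antisymm _ _ h k :=
    Subcomplex.ext (h.1.antisymm k.1) (h.2.1.antisymm k.2.1) (h.2.2.antisymm k.2.2)

/-- Combinatorial maps: each cell is mapped isomorphically onto a cell of the same dimension. -/
structure Hom (X : SquareComplex.{v}) (Y : SquareComplex.{u}) where
  onV : X.V → Y.V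
  onD : X.D → Y.D
  onQ : X.Q → Y.Q
  map_src : ∀ d, Y.src (onD d) = onV (X.src d)
  map_rev : ∀ d, onD (X.rev d) = Y.rev (onD d)
  map_side : ∀ q, Y.side (onQ q) = onD (X.side q)
  map_swap : ∀ q, onQ (X.swap q) = Y.swap (onQ q)
  map_flip : ∀ q, onQ (X.flip q) = Y.flip (onQ q)

namespace Hom

/-- The image of a combinatorial map. -/
def range {X : SquareComplex.{v}} {Y : SquareComplex.{u}} (φ : Hom X Y) : Y.Subcomplex where
  verts := Set.range φ.onV
  darts := Set.range φ.onD
  squares := Set.range φ.onQ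
  src_mem := by rintro _ ⟨d, rfl⟩; exact ⟨_, (φ.map_src d).symm⟩
  rev_mem := by rintro _ ⟨d, rfl⟩; exact ⟨_, φ.map_rev d⟩
  side_mem := by rintro _ ⟨q, rfl⟩; exact ⟨_, (φ.map_side q).symm⟩
  swap_mem := by rintro _ ⟨q, rfl⟩; exact ⟨_, φ.map_swap q⟩
  flip_mem := by rintro _ ⟨q, rfl⟩; exact ⟨_, φ.map_flip q⟩

/-- Injectivity on cells of every dimension. -/
def Injective {X : SquareComplex.{v}} {Y : SquareComplex.{u}} (φ : Hom X Y) : Prop :=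
  Function.Injective φ.onV ∧ Function.Injective φ.onD ∧ Function.Injective φ.onQ

/-- Local isometry. The link of a vertex `x` has as vertices the half-edges `a` with `src a = x`
and as edges the corners of squares at `x`; the corner of `q` joins `side q` to `side (swap q)`.
The three clauses say that each link map is injective on vertices, injective on edges, and that its
image is an induced (full) subcomplex. -/
def IsLocalIsometry {X : SquareComplex.{v}} {Y : SquareComplex.{u}} (φ : Hom X Y) : Prop :=
  (∀ a b : X.D, X.src a = X.src b → φ.onD a = φ.onD b → a = b) ∧
  (∀ p q : X.Q, X.src (X.side p) = X.src (X.side q) → φ.onQ p = φ.onQ q → p = q) ∧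
  (∀ a b : X.D, X.src a = X.src b →
    ∀ r : Y.Q, Y.side r = φ.onD a → Y.side (Y.swap r) = φ.onD b →
      ∃ q : X.Q, X.side q = a ∧ X.side (X.swap q) = b ∧ φ.onQ q = r)

end Hom

/-- The product of two graphs. Its edges are `e × {y}` and `{x} × f`; its squares are `e × f`,
where `inl (a, b)` has first side in the direction of `a` and second side in the direction of `b`,
and `inr (b, a)` has them in the opposite order. -/
def prod (G H : SerreGraph.{u}) : SquareComplex.{u} where
  V := G.V × H.V
  D := (G.D × H.V) ⊕ (G.V × H.D)
  src := Sum.elim (fun p => (G.src p.1, p.2)) (fun p => (p.1, H.src p.2))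
  rev := Sum.map (fun p => (G.rev p.1, p.2)) (fun p => (p.1, H.rev p.2))
  rev_rev := by rintro (⟨a, y⟩ | ⟨x, b⟩) <;> simp [G.rev_rev, H.rev_rev]
  rev_ne := by rintro (⟨a, y⟩ | ⟨x, b⟩) <;> simp [G.rev_ne, H.rev_ne]
  Q := (G.D × H.D) ⊕ (H.D × G.D)
  side := Sum.elim (fun p => Sum.inl (p.1, H.src p.2)) (fun p => Sum.inr (G.src p.2, p.1))
  swap := Sum.elim (fun p => Sum.inr (p.2, p.1)) (fun p => Sum.inl (p.2, p.1))
  flip := Sum.map (fun p => (G.rev p.1, p.2)) (fun p => (H.rev p.1, p.2))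
  swap_swap := by rintro (⟨a, b⟩ | ⟨b, a⟩) <;> rfl
  flip_flip := by rintro (⟨a, b⟩ | ⟨b, a⟩) <;> simp [G.rev_rev, H.rev_rev]
  flip_comm := by rintro (⟨a, b⟩ | ⟨b, a⟩) <;> rfl
  swap_ne := by rintro (⟨a, b⟩ | ⟨b, a⟩) <;> simp
  rot_ne := by rintro (⟨a, b⟩ | ⟨b, a⟩) <;> simp [G.rev_ne, H.rev_ne]
  src_side_swap := by rintro (⟨a, b⟩ | ⟨b, a⟩) <;> rfl
  side_flip := by rintro (⟨a, b⟩ | ⟨b, a⟩) <;> rfl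

/-- A product structure: a local isometry from a product of two graphs which, for some vertices
`x₀` and `y₀`, restricts to isomorphisms of `G × {y₀}` and of `{x₀} × H` onto their images. -/
def IsProductStructure {G H : SerreGraph.{v}} {Y : SquareComplex.{u}}
    (φ : Hom (prod G H) Y) : Prop :=
  φ.IsLocalIsometry ∧
  (∃ y₀ : H.V, Function.Injective (fun x : G.V => φ.onV (x, y₀)) ∧
    Function.Injective (fun a : G.D => φ.onD (Sum.inl (a, y₀)))) ∧
  (∃ x₀ : G.V, Function.Injective (fun y : H.V => φ.onV (x₀, y)) ∧
    Function.Injective (fun b : H.D => φ.onD (Sum.inr (x₀, b))))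

/-- A product subcomplex: the image of a product structure on two connected graphs, each with at
least one edge. -/
def IsProductSubcomplex {Y : SquareComplex.{u}} (K : Y.Subcomplex) : Prop :=
  ∃ (G H : SerreGraph.{u}) (φ : Hom (prod G H) Y),
    G.Connected ∧ G.IsNontrivial ∧ H.Connected ∧ H.IsNontrivial ∧
    IsProductStructure φ ∧ K = φ.range

/-- A standard product subcomplex: as above, with both graphs leafless. -/
def IsStandardProductSubcomplex {Y : SquareComplex.{u}} (K : Y.Subcomplex) : Prop :=
  ∃ (G H : SerreGraph.{u}) (φ : Hom (prod G H) Y),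
    G.Connected ∧ G.IsNontrivial ∧ H.Connected ∧ H.IsNontrivial ∧
    G.Leafless ∧ H.Leafless ∧ IsProductStructure φ ∧ K = φ.range

/-- A maximal product subcomplex: maximal for inclusion among standard product subcomplexes. -/
def IsMaximalProductSubcomplex {Y : SquareComplex.{u}} (K : Y.Subcomplex) : Prop :=
  Maximal IsStandardProductSubcomplex K

end SquareComplex

namespace SerreGraph

open SquareComplex

/-- The unordered discrete `2`-configuration space of a graph. Its cells are the unordered pairs of
disjoint closed cells of the graph: vertices are unordered pairs of distinct vertices; an oriented
edge is a dart together with a vertex off its closed edge; a square is an unordered pair of disjoint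
closed edges, and its eight identifications with `[0,1]²` are the ordered pairs of darts over it,
the first dart giving the first direction. -/
def UD2 (G : SerreGraph.{u}) : SquareComplex.{u} where
  V := {s : Sym2 G.V // ¬ s.IsDiag}
  D := {p : G.D × G.V // G.src p.1 ≠ p.2 ∧ G.tgt p.1 ≠ p.2}
  src p := ⟨s(G.src p.1.1, p.1.2), by simpa using p.2.1⟩
  rev p := ⟨(G.rev p.1.1, p.1.2), p.2.2, by simpa [tgt, G.rev_rev] using p.2.1⟩
  rev_rev p := Subtype.ext (Prod.ext (G.rev_rev _) rfl)
  rev_ne p h := G.rev_ne p.1.1 (congrArg (fun q => q.1.1) h)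
  Q := {p : G.D × G.D // G.src p.1 ≠ G.src p.2 ∧ G.src p.1 ≠ G.tgt p.2 ∧
    G.tgt p.1 ≠ G.src p.2 ∧ G.tgt p.1 ≠ G.tgt p.2}
  side p := ⟨(p.1.1, G.src p.1.2), p.2.1, p.2.2.2.1⟩
  swap p := ⟨(p.1.2, p.1.1), p.2.1.symm, p.2.2.2.1.symm, p.2.2.1.symm, p.2.2.2.2.symm⟩
  flip p := ⟨(G.rev p.1.1, p.1.2), p.2.2.2.1, p.2.2.2.2,
    by simpa [tgt, G.rev_rev] using p.2.1, by simpa [tgt, G.rev_rev] using p.2.2.1⟩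
  swap_swap _ := rfl
  flip_flip p := Subtype.ext (Prod.ext (G.rev_rev _) rfl)
  flip_comm _ := rfl
  swap_ne p h := p.2.1 (congrArg (fun q => G.src q.1.2) h)
  rot_ne p h := G.rev_ne p.1.1 (congrArg (fun q => q.1.1) h)
  src_side_swap _ := Subtype.ext Sym2.eq_swap
  side_flip _ := rfl

/-- The subcomplex of `UD2 G` determined by two subgraphs `A`, `B` of `G`: it consists of the cells
`{σ, τ}` of `UD2 G` with `σ` a cell of `A` and `τ` a cell of `B`. For disjoint `A`, `B` it is the
image of the canonical inclusion of `A × B`. -/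
def boxProd {G : SerreGraph.{u}} (A B : G.Subgraph) : (UD2 G).Subcomplex where
  verts := {s | ∃ a ∈ A.verts, ∃ b ∈ B.verts, s.1 = s(a, b)}
  darts := {p | (p.1.1 ∈ A.darts ∧ p.1.2 ∈ B.verts) ∨ (p.1.1 ∈ B.darts ∧ p.1.2 ∈ A.verts)}
  squares := {p | (p.1.1 ∈ A.darts ∧ p.1.2 ∈ B.darts) ∨ (p.1.1 ∈ B.darts ∧ p.1.2 ∈ A.darts)}
  src_mem := by
    rintro p (⟨h, k⟩ | ⟨h, k⟩)
    · exact ⟨_, A.src_mem _ h, _, k, rfl⟩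
    · exact ⟨_, k, _, B.src_mem _ h, Sym2.eq_swap⟩
  rev_mem := by
    rintro p (⟨h, k⟩ | ⟨h, k⟩)
    · exact Or.inl ⟨A.rev_mem _ h, k⟩
    · exact Or.inr ⟨B.rev_mem _ h, k⟩
  side_mem := by
    rintro p (⟨h, k⟩ | ⟨h, k⟩)
    · exact Or.inl ⟨h, B.src_mem _ k⟩
    · exact Or.inr ⟨h, A.src_mem _ k⟩
  swap_mem := by
    rintro p (⟨h, k⟩ | ⟨h, k⟩)
    · exact Or.inr ⟨k, h⟩
    · exact Or.inl ⟨k, h⟩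
  flip_mem := by
    rintro p (⟨h, k⟩ | ⟨h, k⟩)
    · exact Or.inl ⟨A.rev_mem _ h, k⟩
    · exact Or.inr ⟨B.rev_mem _ h, k⟩

/-- A pair of disjoint connected subgraphs, each with at least one edge. -/
def IsDisjointPair {G : SerreGraph.{u}} (A B : G.Subgraph) : Prop :=
  A.IsDisjoint B ∧ A.coe.Connected ∧ A.coe.IsNontrivial ∧ B.coe.Connected ∧ B.coe.IsNontrivial

/-- A pair of disjoint connected leafless subgraphs, each with at least one edge. -/
def IsStandardPair {G : SerreGraph.{u}} (A B : G.Subgraph) : Prop :=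
  IsDisjointPair A B ∧ A.coe.Leafless ∧ B.coe.Leafless

/-- A pair of disjoint leafless subgraphs, possibly disconnected, all of whose connected components
contain an edge. -/
def IsLeaflessPair {G : SerreGraph.{u}} (A B : G.Subgraph) : Prop :=
  A.IsDisjoint B ∧ A.coe.Leafless ∧ A.coe.NoIsolatedVertex ∧
    B.coe.Leafless ∧ B.coe.NoIsolatedVertex

/-- The pair `(A', B')` enlarges `(A, B)`: both inclusions hold and at least one is proper. -/
def Enlarges {G : SerreGraph.{u}} (A' B' A B : G.Subgraph) : Prop :=
  A ≤ A' ∧ B ≤ B' ∧ (A ≠ A' ∨ B ≠ B')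

end SerreGraph

open SerreGraph SquareComplex

/-! In `UD2 Γ` a square is a pair of disjoint edges, and moving across a side of a square keeps one
of the two darts and reverses the other. Hence, for a combinatorial map from a product of connected
graphs with edges, the dart moved by `a × {y}` does not depend on `y`, and similarly for the other
factor. The map therefore has the form `σ × τ ↦ {f σ, g τ}` for graph morphisms `f`, `g` with
disjoint images (`exists_splits`), and its image is the box of the two images. The slice condition
in a product structure makes `f` and `g` injective; disjointness of their images then makes the
whole map injective, and leaflessness passes to the images. Conversely, the inclusions of two
disjoint subgraphs give a product structure.

For inclusions of boxes, one vertex `{x, y}` of `A ⊠ B` decides which factor of `C ⊠ D` contains `x`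
and which contains `y`. Fixing `y` and varying the other cell then gives the inclusion of the whole
factor (`left_le_of_boxProd_le`). Maximality among connected pairs follows from this.

For possibly disconnected pairs, suppose that `A` is properly contained in a leafless `A'` off `B`.
A component `C` of `A'` contains an edge outside `A`. Since `Γ` is connected, `C` either meets `A`,
or is reached from `A` off `B`, or is reached from `B` off `A`. Joining `C` by a tail to the
subgraph from which it is reached creates no leaves, so a connected enlargement exists; it may
enlarge `B` rather than `A`. -/

namespace SerreGraph

/-! ### Graph morphisms and their images -/

/-- Morphisms of graphs, mapping vertices to vertices and edges to edges. -/
structure GraphMap (G : SerreGraph.{v}) (Γ : SerreGraph.{u}) where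
  onV : G.V → Γ.V
  onD : G.D → Γ.D
  map_src : ∀ d, Γ.src (onD d) = onV (G.src d)
  map_rev : ∀ d, onD (G.rev d) = Γ.rev (onD d)

/-- This allows every vertex to be written as the source of a dart, so that statements about
vertices can be read off squares. -/
theorem Connected.noIsolatedVertex {G : SerreGraph.{u}} (hG : G.Connected)
    (hG' : G.IsNontrivial) : G.NoIsolatedVertex := by
  intro x
  obtain ⟨d⟩ := hG'
  rcases Relation.ReflTransGen.cases_head (hG.2 x (G.src d)) with h | ⟨c, ⟨e, he, -⟩, -⟩
  · exact ⟨d, h.symm⟩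
  · exact ⟨e, he⟩

/-- A function on vertices that agrees on the endpoints of every edge of a connected graph is
constant. -/
theorem Connected.eq_of_forall_dart {G : SerreGraph.{u}} {α : Type*} (hG : G.Connected)
    (f : G.V → α) (hf : ∀ d, f (G.tgt d) = f (G.src d)) (x y : G.V) : f x = f y := by
  induction hG.2 x y with
  | refl => rfl
  | tail _ h ih =>
    obtain ⟨d, rfl, rfl⟩ := h
    rw [ih, hf]

namespace GraphMap

variable {G : SerreGraph.{v}} {Γ : SerreGraph.{u}}

/-- The image of a morphism of graphs. -/
def range (f : GraphMap G Γ) : Γ.Subgraph where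
  verts := Set.range f.onV
  darts := Set.range f.onD
  src_mem := by rintro _ ⟨d, rfl⟩; exact ⟨_, (f.map_src d).symm⟩
  rev_mem := by rintro _ ⟨d, rfl⟩; exact ⟨_, f.map_rev d⟩

theorem map_tgt (f : GraphMap G Γ) (d : G.D) : Γ.tgt (f.onD d) = f.onV (G.tgt d) := by
  rw [tgt, ← f.map_rev, f.map_src, tgt]

theorem connected_range (f : GraphMap G Γ) (hG : G.Connected) : f.range.coe.Connected := by
  obtain ⟨⟨x⟩, h⟩ := hG
  refine ⟨⟨⟨f.onV x, x, rfl⟩⟩, ?_⟩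
  rintro ⟨_, a, rfl⟩ ⟨_, b, rfl⟩
  refine Relation.ReflTransGen.lift
    (fun y : G.V => (⟨f.onV y, y, rfl⟩ : f.range.coe.V)) ?_ _ _ (h a b)
  rintro _ _ ⟨d, rfl, rfl⟩
  exact ⟨⟨f.onD d, d, rfl⟩, Subtype.ext (f.map_src d), Subtype.ext (f.map_tgt d)⟩

theorem isNontrivial_range (f : GraphMap G Γ) (hG : G.IsNontrivial) :
    f.range.coe.IsNontrivial := by
  obtain ⟨d⟩ := hG
  exact ⟨⟨f.onD d, d, rfl⟩⟩

/-- An embedding preserves valencies. A non-injective morphism could fold half-edges together and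
create leaves. -/
theorem leafless_range (f : GraphMap G Γ) (hV : Function.Injective f.onV)
    (hD : Function.Injective f.onD) (hG : G.Leafless) : f.range.coe.Leafless := by
  rintro ⟨_, x, rfl⟩ ⟨⟨_, d, rfl⟩, hd, huniq⟩
  have hd' : f.onV (G.src d) = f.onV x := by
    rw [← f.map_src]; exact congrArg Subtype.val hd
  refine hG x ⟨d, hV hd', fun e he => hD ?_⟩
  refine congrArg Subtype.val (huniq ⟨f.onD e, e, rfl⟩ (Subtype.ext ?_))
  exact (f.map_src e).trans (congrArg f.onV he)

end GraphMap

/-! ### Splitting of combinatorial maps from products -/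

section ProductStructures

variable {G H : SerreGraph.{v}} {Γ : SerreGraph.{u}}

/-- The map `φ` sends the cell `σ × τ` to the cell `{f σ, g τ}`, and `f`, `g` have disjoint
images. -/
structure Splits (φ : SquareComplex.Hom (SquareComplex.prod G H) (UD2 Γ))
    (f : GraphMap G Γ) (g : GraphMap H Γ) : Prop where
  ne : ∀ x y, f.onV x ≠ g.onV y
  onV : ∀ x y, (φ.onV (x, y)).1 = s(f.onV x, g.onV y)
  inl : ∀ a y, (φ.onD (Sum.inl (a, y))).1 = (f.onD a, g.onV y)
  inr : ∀ x b, (φ.onD (Sum.inr (x, b))).1 = (g.onD b, f.onV x)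
  onQ : ∀ a b, (φ.onQ (Sum.inl (a, b))).1 = (f.onD a, g.onD b)

/-- Every combinatorial map from a product of connected graphs with edges to `UD2 Γ` splits. -/
theorem exists_splits (φ : SquareComplex.Hom (SquareComplex.prod G H) (UD2 Γ))
    (hG : G.Connected) (hG' : G.IsNontrivial) (hH : H.Connected) (hH' : H.IsNontrivial) :
    ∃ (f : GraphMap G Γ) (g : GraphMap H Γ), Splits φ f g := by
  have hside : ∀ a b, (φ.onD (Sum.inl (a, H.src b))).1 =
      ((φ.onQ (Sum.inl (a, b))).1.1, Γ.src (φ.onQ (Sum.inl (a, b))).1.2) := fun a b =>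
    (congrArg Subtype.val (φ.map_side (Sum.inl (a, b)))).symm
  have hswap : ∀ a b, (φ.onQ (Sum.inr (b, a))).1 =
      ((φ.onQ (Sum.inl (a, b))).1.2, (φ.onQ (Sum.inl (a, b))).1.1) := fun a b =>
    congrArg Subtype.val (φ.map_swap (Sum.inl (a, b)))
  have hside' : ∀ a b, (φ.onD (Sum.inr (G.src a, b))).1 =
      ((φ.onQ (Sum.inl (a, b))).1.2, Γ.src (φ.onQ (Sum.inl (a, b))).1.1) := by
    intro a b
    have h := (congrArg Subtype.val (φ.map_side (Sum.inr (b, a)))).symm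
    refine h.trans ?_
    change ((φ.onQ (Sum.inr (b, a))).1.1, Γ.src (φ.onQ (Sum.inr (b, a))).1.2) = _
    rw [hswap]
  have hflip : ∀ a b, (φ.onQ (Sum.inl (G.rev a, b))).1 =
      (Γ.rev (φ.onQ (Sum.inl (a, b))).1.1, (φ.onQ (Sum.inl (a, b))).1.2) := fun a b =>
    congrArg Subtype.val (φ.map_flip (Sum.inl (a, b)))
  have hflip' : ∀ a b, (φ.onQ (Sum.inl (a, H.rev b))).1 =
      ((φ.onQ (Sum.inl (a, b))).1.1, Γ.rev (φ.onQ (Sum.inl (a, b))).1.2) := by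
    intro a b
    have h : (φ.onQ (Sum.inr (H.rev b, a))).1 =
      (Γ.rev (φ.onQ (Sum.inr (b, a))).1.1, (φ.onQ (Sum.inr (b, a))).1.2) :=
      congrArg Subtype.val (φ.map_flip (Sum.inr (b, a)))
    rw [hswap, hswap] at h
    exact Prod.ext (congrArg Prod.snd h) (congrArg Prod.fst h)
  have hG0 := hG.noIsolatedVertex hG'
  have hH0 := hH.noIsolatedVertex hH'
  obtain ⟨⟨x₀⟩, -⟩ := id hG
  obtain ⟨⟨y₀⟩, -⟩ := id hH
  -- the first dart of the image does not depend on the second factor, and vice versa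
  have hα : ∀ a y, (φ.onD (Sum.inl (a, y))).1.1 = (φ.onD (Sum.inl (a, y₀))).1.1 := fun a y =>
    hH.eq_of_forall_dart (fun y => (φ.onD (Sum.inl (a, y))).1.1)
      (fun b => by
        change (φ.onD (Sum.inl (a, H.src (H.rev b)))).1.1 = (φ.onD (Sum.inl (a, H.src b))).1.1
        rw [hside, hside, hflip']) y y₀
  have hβ : ∀ x b, (φ.onD (Sum.inr (x, b))).1.1 = (φ.onD (Sum.inr (x₀, b))).1.1 := fun x b =>
    hG.eq_of_forall_dart (fun x => (φ.onD (Sum.inr (x, b))).1.1)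
      (fun a => by
        change (φ.onD (Sum.inr (G.src (G.rev a), b))).1.1 = (φ.onD (Sum.inr (G.src a, b))).1.1
        rw [hside', hside', hflip]) x x₀
  obtain ⟨a₀⟩ := hG'
  obtain ⟨b₀⟩ := hH'
  have hQ : ∀ a b, (φ.onQ (Sum.inl (a, b))).1 =
      ((φ.onD (Sum.inl (a, y₀))).1.1, (φ.onD (Sum.inr (x₀, b))).1.1) := by
    intro a b
    rw [← hα a (H.src b), ← hβ (G.src a) b, hside, hside']
  have hr : ∀ a b, (φ.onD (Sum.inr (G.src a, b))).1.2 = Γ.src (φ.onD (Sum.inl (a, y₀))).1.1 := by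
    intro a b
    rw [hside', hQ]
  have hp : ∀ a b, (φ.onD (Sum.inl (a, H.src b))).1.2 = Γ.src (φ.onD (Sum.inr (x₀, b))).1.1 := by
    intro a b
    rw [hside, hQ]
  -- On vertices, `f` records the stationary vertex of the edge `{x} × b₀`; by `hr` the choice of
  -- `b₀` is immaterial. The same holds for `g` with `a₀` and `hp`.
  let f : GraphMap G Γ :=
    { onV := fun x => (φ.onD (Sum.inr (x, b₀))).1.2
      onD := fun a => (φ.onD (Sum.inl (a, y₀))).1.1
      map_src := fun a => (hr a b₀).symm
      map_rev := fun a => by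
        have := congrArg Prod.fst (hflip a b₀)
        rwa [hQ, hQ] at this }
  let g : GraphMap H Γ :=
    { onV := fun y => (φ.onD (Sum.inl (a₀, y))).1.2
      onD := fun b => (φ.onD (Sum.inr (x₀, b))).1.1
      map_src := fun b => (hp a₀ b).symm
      map_rev := fun b => by
        have := congrArg Prod.snd (hflip' a₀ b)
        rwa [hQ, hQ] at this }
  have hinl : ∀ a y, (φ.onD (Sum.inl (a, y))).1 = (f.onD a, g.onV y) := by
    intro a y
    obtain ⟨b, rfl⟩ := hH0 y
    exact Prod.ext (hα _ _) ((hp a b).trans (hp a₀ b).symm)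
  refine ⟨f, g, ?_, ?_, hinl, ?_, hQ⟩
  -- The point `(x, y)` is a corner of some square `a × b`, whose image consists of two disjoint
  -- edges.
  · intro x y
    obtain ⟨a, rfl⟩ := hG0 x
    obtain ⟨b, rfl⟩ := hH0 y
    have h := (φ.onQ (Sum.inl (a, b))).2.1
    rw [hQ] at h
    rw [← f.map_src, ← g.map_src]
    exact h
  · intro x y
    obtain ⟨a, rfl⟩ := hG0 x
    have h : s(Γ.src (φ.onD (Sum.inl (a, y))).1.1, (φ.onD (Sum.inl (a, y))).1.2) =
        (φ.onV (G.src a, y)).1 := congrArg Subtype.val (φ.map_src (Sum.inl (a, y)))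
    rw [← h, hinl, f.map_src]
  · intro x b
    obtain ⟨a, rfl⟩ := hG0 x
    exact Prod.ext (hβ _ _) ((hr a b).trans (hr a b₀).symm)

namespace Splits

variable {φ : SquareComplex.Hom (SquareComplex.prod G H) (UD2 Γ)}
  {f : GraphMap G Γ} {g : GraphMap H Γ}

theorem onQ_inr (h : Splits φ f g) (b : H.D) (a : G.D) :
    (φ.onQ (Sum.inr (b, a))).1 = (g.onD b, f.onD a) := by
  have h' : (φ.onQ (Sum.inr (b, a))).1 =
      ((φ.onQ (Sum.inl (a, b))).1.2, (φ.onQ (Sum.inl (a, b))).1.1) :=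
    congrArg Subtype.val (φ.map_swap (Sum.inl (a, b)))
  rw [h', h.onQ]

theorem range_eq (h : Splits φ f g) : φ.range = boxProd f.range g.range := by
  apply Subcomplex.ext
  · ext s
    constructor
    · rintro ⟨⟨x, y⟩, rfl⟩
      exact ⟨_, ⟨x, rfl⟩, _, ⟨y, rfl⟩, h.onV x y⟩
    · rintro ⟨_, ⟨x, rfl⟩, _, ⟨y, rfl⟩, hs⟩
      exact ⟨(x, y), Subtype.ext ((h.onV x y).trans hs.symm)⟩
  · ext p
    constructor
    · rintro ⟨⟨a, y⟩ | ⟨x, b⟩, rfl⟩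
      · refine Or.inl ?_
        rw [h.inl]
        exact ⟨⟨a, rfl⟩, ⟨y, rfl⟩⟩
      · refine Or.inr ?_
        rw [h.inr]
        exact ⟨⟨b, rfl⟩, ⟨x, rfl⟩⟩
    · rintro (⟨⟨a, ha⟩, ⟨y, hy⟩⟩ | ⟨⟨b, hb⟩, ⟨x, hx⟩⟩)
      · exact ⟨Sum.inl (a, y), Subtype.ext ((h.inl a y).trans (Prod.ext ha hy))⟩
      · exact ⟨Sum.inr (x, b), Subtype.ext ((h.inr x b).trans (Prod.ext hb hx))⟩
  · ext p
    constructor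
    · rintro ⟨⟨a, b⟩ | ⟨b, a⟩, rfl⟩
      · refine Or.inl ?_
        rw [h.onQ]
        exact ⟨⟨a, rfl⟩, ⟨b, rfl⟩⟩
      · refine Or.inr ?_
        rw [h.onQ_inr]
        exact ⟨⟨b, rfl⟩, ⟨a, rfl⟩⟩
    · rintro (⟨⟨a, ha⟩, ⟨b, hb⟩⟩ | ⟨⟨b, hb⟩, ⟨a, ha⟩⟩)
      · exact ⟨Sum.inl (a, b), Subtype.ext ((h.onQ a b).trans (Prod.ext ha hb))⟩
      · exact ⟨Sum.inr (b, a), Subtype.ext ((h.onQ_inr b a).trans (Prod.ext hb ha))⟩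

theorem isDisjoint (h : Splits φ f g) : f.range.IsDisjoint g.range := by
  refine Set.disjoint_left.2 ?_
  rintro _ ⟨x, rfl⟩ ⟨y, hy⟩
  exact h.ne x y hy.symm

/-- Disjointness of the two images prevents an unordered pair from being matched with its
coordinates exchanged; what remains is injectivity in each factor. -/
theorem injective (h : Splits φ f g) (hfV : Function.Injective f.onV)
    (hfD : Function.Injective f.onD) (hgV : Function.Injective g.onV)
    (hgD : Function.Injective g.onD) : φ.Injective := by
  refine ⟨?_, ?_, ?_⟩
  · rintro ⟨x, y⟩ ⟨x', y'⟩ e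
    have e' := congrArg Subtype.val e
    rw [h.onV, h.onV, Sym2.eq_iff] at e'
    rcases e' with ⟨h1, h2⟩ | ⟨h1, -⟩
    · exact Prod.ext (hfV h1) (hgV h2)
    · exact absurd h1 (h.ne _ _)
  · rintro (⟨a, y⟩ | ⟨x, b⟩) (⟨a', y'⟩ | ⟨x', b'⟩) e
    all_goals
      have e' := congrArg Subtype.val e
      simp only [h.inl, h.inr, Prod.mk.injEq] at e'
    · rw [hfD e'.1, hgV e'.2]
    · exact absurd e'.2.symm (h.ne _ _)
    · exact absurd e'.2 (h.ne _ _)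
    · rw [hgD e'.1, hfV e'.2]
  · rintro (⟨a, b⟩ | ⟨b, a⟩) (⟨a', b'⟩ | ⟨b', a'⟩) e
    all_goals
      have e' := congrArg Subtype.val e
      simp only [h.onQ, h.onQ_inr, Prod.mk.injEq] at e'
    · rw [hfD e'.1, hgD e'.2]
    · have := congrArg Γ.src e'.1
      rw [f.map_src, g.map_src] at this
      exact absurd this (h.ne _ _)
    · have := congrArg Γ.src e'.2
      rw [f.map_src, g.map_src] at this
      exact absurd this (h.ne _ _)
    · rw [hgD e'.1, hfD e'.2]

/-- The factors of a product structure are embedded. -/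
theorem injective_factors (h : Splits φ f g) (hφ : IsProductStructure φ) :
    (Function.Injective f.onV ∧ Function.Injective f.onD) ∧
      Function.Injective g.onV ∧ Function.Injective g.onD := by
  -- A coincidence under `f` would give a coincidence in the slice over `y₀`, where `φ` is
  -- injective; likewise for `g` over `x₀`.
  obtain ⟨-, ⟨y₀, hV, hD⟩, ⟨x₀, hV', hD'⟩⟩ := hφ
  refine ⟨⟨fun x x' e => hV (Subtype.ext ?_), fun a a' e => hD (Subtype.ext ?_)⟩,
    fun y y' e => hV' (Subtype.ext ?_), fun b b' e => hD' (Subtype.ext ?_)⟩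
  · rw [h.onV, h.onV, e]
  · rw [h.inl, h.inl, e]
  · rw [h.onV, h.onV, e]
  · rw [h.inr, h.inr, e]

/-- Only fullness of the link image needs an argument. If both sides of `r` came from the same
factor, the stationary vertex of one side, being the source of the other, would lie in both images.
So the sides come from different factors and already span a square of the product. -/
theorem isLocalIsometry (h : Splits φ f g) (hφ : φ.Injective) : φ.IsLocalIsometry := by
  refine ⟨fun a b _ e => hφ.2.1 e, fun p q _ e => hφ.2.2 e, ?_⟩
  intro a b hab r hr hr'
  have e : (r.1.1, Γ.src r.1.2) = (φ.onD a).1 := congrArg Subtype.val hr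
  have e' : (r.1.2, Γ.src r.1.1) = (φ.onD b).1 := congrArg Subtype.val hr'
  rcases a with ⟨a, y⟩ | ⟨x, a⟩ <;> rcases b with ⟨b, y'⟩ | ⟨x', b⟩ <;>
    simp only [h.inl, h.inr, Prod.mk.injEq] at e e'
  · rw [e'.1, f.map_src] at e
    exact absurd e.2 (h.ne _ _)
  · obtain ⟨h1, h2⟩ := Prod.mk.inj hab
    refine ⟨Sum.inl (a, b), ?_, ?_, Subtype.ext ((h.onQ a b).trans (Prod.ext e.1.symm e'.1.symm))⟩
    · exact congrArg (fun z => Sum.inl (a, z)) h2.symm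
    · exact congrArg (fun z => Sum.inr (z, b)) h1
  · obtain ⟨h1, h2⟩ := Prod.mk.inj hab
    refine ⟨Sum.inr (a, b), ?_, ?_,
      Subtype.ext ((h.onQ_inr a b).trans (Prod.ext e.1.symm e'.1.symm))⟩
    · exact congrArg (fun z => Sum.inr (z, a)) h1.symm
    · exact congrArg (fun z => Sum.inl (b, z)) h2
  · rw [e'.1, g.map_src] at e
    exact absurd e.2.symm (h.ne _ _)

theorem isProductStructure (h : Splits φ f g) (hφ : φ.Injective) (x₀ : G.V) (y₀ : H.V) :
    IsProductStructure φ := by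
  refine ⟨h.isLocalIsometry hφ, ⟨y₀, fun x x' e => ?_, fun a a' e => ?_⟩,
    ⟨x₀, fun y y' e => ?_, fun b b' e => ?_⟩⟩
  · exact congrArg Prod.fst (hφ.1 e)
  · exact congrArg Prod.fst (Sum.inl.inj (hφ.2.1 e))
  · exact congrArg Prod.snd (hφ.1 e)
  · exact congrArg Prod.snd (Sum.inr.inj (hφ.2.1 e))

end Splits

/-- The combinatorial map `σ × τ ↦ {f σ, g τ}` determined by two graph morphisms with disjoint
images. -/
def boxHom (f : GraphMap G Γ) (g : GraphMap H Γ) (h : ∀ x y, f.onV x ≠ g.onV y) :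
    SquareComplex.Hom (SquareComplex.prod G H) (UD2 Γ) where
  onV p := ⟨s(f.onV p.1, g.onV p.2), by simpa using h p.1 p.2⟩
  onD := Sum.elim
    (fun p => ⟨(f.onD p.1, g.onV p.2), by rw [f.map_src]; exact h _ _,
      by rw [f.map_tgt]; exact h _ _⟩)
    (fun p => ⟨(g.onD p.2, f.onV p.1), by rw [g.map_src]; exact (h _ _).symm,
      by rw [g.map_tgt]; exact (h _ _).symm⟩)
  onQ := Sum.elim
    (fun p => ⟨(f.onD p.1, g.onD p.2), by
      simp only [f.map_src, g.map_src, f.map_tgt, g.map_tgt]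
      exact ⟨h _ _, h _ _, h _ _, h _ _⟩⟩)
    (fun p => ⟨(g.onD p.1, f.onD p.2), by
      simp only [f.map_src, g.map_src, f.map_tgt, g.map_tgt]
      exact ⟨(h _ _).symm, (h _ _).symm, (h _ _).symm, (h _ _).symm⟩⟩)
  map_src := by
    rintro (⟨a, y⟩ | ⟨x, b⟩)
    · exact Subtype.ext (congrArg (fun z => s(z, g.onV y)) (f.map_src a))
    · exact Subtype.ext ((congrArg (fun z => s(z, f.onV x)) (g.map_src b)).trans Sym2.eq_swap)
  map_rev := by
    rintro (⟨a, y⟩ | ⟨x, b⟩)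
    · exact Subtype.ext (Prod.ext (f.map_rev a) rfl)
    · exact Subtype.ext (Prod.ext (g.map_rev b) rfl)
  map_side := by
    rintro (⟨a, b⟩ | ⟨b, a⟩)
    · exact Subtype.ext (Prod.ext rfl (g.map_src b))
    · exact Subtype.ext (Prod.ext rfl (f.map_src a))
  map_swap := by rintro (⟨a, b⟩ | ⟨b, a⟩) <;> rfl
  map_flip := by
    rintro (⟨a, b⟩ | ⟨b, a⟩)
    · exact Subtype.ext (Prod.ext (f.map_rev a) rfl)
    · exact Subtype.ext (Prod.ext (g.map_rev b) rfl)

theorem splits_boxHom (f : GraphMap G Γ) (g : GraphMap H Γ) (h : ∀ x y, f.onV x ≠ g.onV y) :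
    Splits (boxHom f g h) f g :=
  ⟨h, fun _ _ => rfl, fun _ _ => rfl, fun _ _ => rfl, fun _ _ => rfl⟩

end ProductStructures

/-! ### Inclusions between boxes -/

namespace Subgraph

variable {Γ : SerreGraph.{u}}

/-- The inclusion of a subgraph. -/
def incl (A : Γ.Subgraph) : GraphMap A.coe Γ where
  onV := Subtype.val
  onD := Subtype.val
  map_src _ := rfl
  map_rev _ := rfl

theorem range_incl (A : Γ.Subgraph) : A.incl.range = A :=
  Subgraph.ext Subtype.range_val Subtype.range_val

theorem IsDisjoint.symm {A B : Γ.Subgraph} (h : A.IsDisjoint B) : B.IsDisjoint A :=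
  Disjoint.symm h

end Subgraph

variable {Γ : SerreGraph.{u}} {A B C D : Γ.Subgraph}

theorem IsDisjointPair.symm (h : IsDisjointPair A B) : IsDisjointPair B A :=
  ⟨h.1.symm, h.2.2.2.1, h.2.2.2.2, h.2.1, h.2.2.1⟩

theorem IsStandardPair.symm (h : IsStandardPair A B) : IsStandardPair B A :=
  ⟨h.1.symm, h.2.2, h.2.1⟩

theorem boxProd_comm (A B : Γ.Subgraph) : boxProd A B = boxProd B A := by
  apply Subcomplex.ext
  · ext s
    constructor
    · rintro ⟨a, ha, b, hb, e⟩
      exact ⟨b, hb, a, ha, e.trans Sym2.eq_swap⟩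
    · rintro ⟨a, ha, b, hb, e⟩
      exact ⟨b, hb, a, ha, e.trans Sym2.eq_swap⟩
  · ext p
    exact Or.comm
  · ext p
    exact Or.comm

theorem boxProd_mono (hA : A ≤ C) (hB : B ≤ D) : boxProd A B ≤ boxProd C D := by
  refine ⟨?_, ?_, ?_⟩
  · rintro s ⟨a, ha, b, hb, e⟩
    exact ⟨a, hA.1 ha, b, hB.1 hb, e⟩
  · rintro p (⟨h, k⟩ | ⟨h, k⟩)
    · exact Or.inl ⟨hA.2 h, hB.1 k⟩
    · exact Or.inr ⟨hB.2 h, hA.1 k⟩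
  · rintro p (⟨h, k⟩ | ⟨h, k⟩)
    · exact Or.inl ⟨hA.2 h, hB.2 k⟩
    · exact Or.inr ⟨hB.2 h, hA.2 k⟩

/-- If a vertex of `B` lies in `D`, then an inclusion `A ⊠ B ≤ C ⊠ D` forces `A ≤ C`. -/
theorem left_le_of_boxProd_le (hAB : A.IsDisjoint B) (hCD : C.IsDisjoint D)
    (h : boxProd A B ≤ boxProd C D) {y : Γ.V} (hyB : y ∈ B.verts) (hyD : y ∈ D.verts) :
    A ≤ C := by
  have hAy : ∀ x ∈ A.verts, x ≠ y := fun x hx e => Set.disjoint_left.1 hAB hx (e ▸ hyB)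
  have hyC : y ∉ C.verts := Set.disjoint_right.1 hCD hyD
  constructor
  -- Since `y` lies in `D`, it is not in `C`; so in the pair `{x, y}` the entry from `C` must be
  -- `x`.
  · intro x hx
    obtain ⟨c, hc, d, -, e⟩ := h.1
      (show (⟨s(x, y), by simpa using hAy x hx⟩ : (UD2 Γ).V) ∈ (boxProd A B).verts from
        ⟨x, hx, y, hyB, rfl⟩)
    rcases Sym2.eq_iff.1 e with ⟨rfl, -⟩ | ⟨-, rfl⟩
    · exact hc
    · exact absurd hc hyC
  · intro a ha
    rcases h.2.1
      (show (⟨(a, y), hAy _ (A.src_mem a ha), hAy _ (A.src_mem _ (A.rev_mem a ha))⟩ : (UD2 Γ).D) ∈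
        (boxProd A B).darts from Or.inl ⟨ha, hyB⟩) with ⟨h', -⟩ | ⟨-, h'⟩
    · exact h'
    · exact absurd h' hyC

/-- The position of a single vertex `{x, y}` of `A ⊠ B` selects one of the two alternatives, and
`left_le_of_boxProd_le` then applies to each factor in turn. -/
theorem boxProd_le_iff (hAB : IsDisjointPair A B) (hCD : IsDisjointPair C D) :
    boxProd A B ≤ boxProd C D ↔ (A ≤ C ∧ B ≤ D) ∨ (A ≤ D ∧ B ≤ C) := by
  constructor
  · intro h
    obtain ⟨⟨x, hx⟩⟩ := hAB.2.1.1
    obtain ⟨⟨y, hy⟩⟩ := hAB.2.2.2.1.1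
    have hxy : x ≠ y := fun e => Set.disjoint_left.1 hAB.1 hx (e ▸ hy)
    have h₁ : boxProd B A ≤ boxProd D C := by rwa [boxProd_comm B, boxProd_comm D]
    have h₂ : boxProd A B ≤ boxProd D C := by rwa [boxProd_comm D]
    have h₃ : boxProd B A ≤ boxProd C D := by rwa [boxProd_comm B]
    obtain ⟨c, hc, d, hd, e⟩ := h.1
      (show (⟨s(x, y), by simpa using hxy⟩ : (UD2 Γ).V) ∈ (boxProd A B).verts from
        ⟨x, hx, y, hy, rfl⟩)
    rcases Sym2.eq_iff.1 e with ⟨rfl, rfl⟩ | ⟨rfl, rfl⟩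
    · exact Or.inl ⟨left_le_of_boxProd_le hAB.1 hCD.1 h hy hd,
        left_le_of_boxProd_le hAB.1.symm hCD.1.symm h₁ hx hc⟩
    · exact Or.inr ⟨left_le_of_boxProd_le hAB.1 hCD.1.symm h₂ hy hc,
        left_le_of_boxProd_le hAB.1.symm hCD.1 h₃ hx hd⟩
  · rintro (⟨h, k⟩ | ⟨h, k⟩)
    · exact boxProd_mono h k
    · rw [boxProd_comm C]
      exact boxProd_mono h k

/-- Disjoint nonempty subgraphs are not nested. -/
theorem IsDisjointPair.not_le (h : IsDisjointPair A B) : ¬ A ≤ B := by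
  intro hle
  obtain ⟨⟨x, hx⟩⟩ := h.2.1.1
  exact Set.disjoint_left.1 h.1 hx (hle.1 hx)

theorem boxProd_eq_iff (hAB : IsDisjointPair A B) (hCD : IsDisjointPair C D) :
    boxProd A B = boxProd C D ↔ (A = C ∧ B = D) ∨ (A = D ∧ B = C) := by
  constructor
  · intro h
    -- If exactly one of the two inclusions swaps the factors, composing them gives `A ≤ B`.
    rcases (boxProd_le_iff hAB hCD).1 h.le with ⟨h1, h2⟩ | ⟨h1, h2⟩ <;>
      rcases (boxProd_le_iff hCD hAB).1 h.ge with ⟨h3, h4⟩ | ⟨h3, h4⟩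
    · exact Or.inl ⟨le_antisymm h1 h3, le_antisymm h2 h4⟩
    · exact absurd (h1.trans h3) hAB.not_le
    · exact absurd (h1.trans h4) hAB.not_le
    · exact Or.inr ⟨le_antisymm h1 h4, le_antisymm h2 h3⟩
  · rintro (⟨rfl, rfl⟩ | ⟨rfl, rfl⟩)
    · rfl
    · exact boxProd_comm _ _

/-! ### Classification of product subcomplexes and maximality among connected pairs -/

/-- The inclusions of two disjoint subgraphs give a product structure with image `A ⊠ B`. -/
theorem IsDisjointPair.exists_isProductStructure (h : IsDisjointPair A B) :
    ∃ φ : SquareComplex.Hom (SquareComplex.prod A.coe B.coe) (UD2 Γ),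
      IsProductStructure φ ∧ boxProd A B = φ.range := by
  have hne : ∀ x y, A.incl.onV x ≠ B.incl.onV y := fun x y e =>
    Set.disjoint_left.1 h.1 x.2 (by rw [show x.1 = y.1 from e]; exact y.2)
  have hs := splits_boxHom A.incl B.incl hne
  obtain ⟨x₀⟩ := h.2.1.1
  obtain ⟨y₀⟩ := h.2.2.2.1.1
  refine ⟨_, hs.isProductStructure (hs.injective Subtype.val_injective Subtype.val_injective
    Subtype.val_injective Subtype.val_injective) x₀ y₀, ?_⟩
  rw [hs.range_eq, A.range_incl, B.range_incl]

theorem isProductSubcomplex_iff (K : (UD2 Γ).Subcomplex) :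
    IsProductSubcomplex K ↔ ∃ A B : Γ.Subgraph, IsDisjointPair A B ∧ K = boxProd A B := by
  constructor
  · rintro ⟨G, H, φ, hG, hG', hH, hH', -, rfl⟩
    obtain ⟨f, g, h⟩ := exists_splits φ hG hG' hH hH'
    exact ⟨f.range, g.range, ⟨h.isDisjoint, f.connected_range hG, f.isNontrivial_range hG',
      g.connected_range hH, g.isNontrivial_range hH'⟩, h.range_eq⟩
  · rintro ⟨A, B, h, rfl⟩
    obtain ⟨φ, hφ, e⟩ := h.exists_isProductStructure
    exact ⟨A.coe, B.coe, φ, h.2.1, h.2.2.1, h.2.2.2.1, h.2.2.2.2, hφ, e⟩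

theorem isStandardProductSubcomplex_iff (K : (UD2 Γ).Subcomplex) :
    IsStandardProductSubcomplex K ↔
      ∃ A B : Γ.Subgraph, IsStandardPair A B ∧ K = boxProd A B := by
  constructor
  · rintro ⟨G, H, φ, hG, hG', hH, hH', lG, lH, hφ, rfl⟩
    obtain ⟨f, g, h⟩ := exists_splits φ hG hG' hH hH'
    -- Embeddedness of the factors is what carries leaflessness over to the images.
    obtain ⟨hf, hg⟩ := h.injective_factors hφ
    exact ⟨f.range, g.range, ⟨⟨h.isDisjoint, f.connected_range hG, f.isNontrivial_range hG',
      g.connected_range hH, g.isNontrivial_range hH'⟩, f.leafless_range hf.1 hf.2 lG,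
      g.leafless_range hg.1 hg.2 lH⟩, h.range_eq⟩
  · rintro ⟨A, B, ⟨h, lA, lB⟩, rfl⟩
    obtain ⟨φ, hφ, e⟩ := h.exists_isProductStructure
    exact ⟨A.coe, B.coe, φ, h.2.1, h.2.2.1, h.2.2.2.1, h.2.2.2.2, lA, lB, hφ, e⟩

theorem isStandardProductSubcomplex_boxProd_iff (h : IsDisjointPair A B) :
    IsStandardProductSubcomplex (boxProd A B) ↔ A.coe.Leafless ∧ B.coe.Leafless := by
  rw [isStandardProductSubcomplex_iff]
  constructor
  · rintro ⟨C, D, hCD, e⟩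
    rcases (boxProd_eq_iff h hCD.1).1 e with ⟨rfl, rfl⟩ | ⟨rfl, rfl⟩
    · exact hCD.2
    · exact hCD.2.symm
  · intro hl
    exact ⟨A, B, ⟨h, hl⟩, rfl⟩

theorem injective_of_isProductStructure {G H : SerreGraph.{v}}
    (φ : SquareComplex.Hom (SquareComplex.prod G H) (UD2 Γ))
    (hG : G.Connected) (hG' : G.IsNontrivial) (hH : H.Connected) (hH' : H.IsNontrivial)
    (hφ : IsProductStructure φ) : φ.Injective := by
  obtain ⟨f, g, h⟩ := exists_splits φ hG hG' hH hH'
  obtain ⟨hf, hg⟩ := h.injective_factors hφ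
  exact h.injective hf.1 hf.2 hg.1 hg.2

theorem isMaximalProductSubcomplex_boxProd_iff (h : IsDisjointPair A B) :
    IsMaximalProductSubcomplex (boxProd A B) ↔ IsStandardProductSubcomplex (boxProd A B) ∧
      ¬ ∃ A' B' : Γ.Subgraph, IsStandardPair A' B' ∧ Enlarges A' B' A B := by
  refine and_congr_right fun _ => ?_
  constructor
  · rintro hmax ⟨A', B', hs, hA, hB, hne⟩
    have hle := hmax ((isStandardProductSubcomplex_iff _).2 ⟨A', B', hs, rfl⟩)
      (boxProd_mono hA hB)
    rcases (boxProd_le_iff hs.1 h).1 hle with ⟨h1, h2⟩ | ⟨h1, -⟩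
    · exact hne.elim (fun k => k (le_antisymm hA h1)) fun k => k (le_antisymm hB h2)
    -- In the swapped case `A ≤ A' ≤ B`, contrary to disjointness.
    · exact h.not_le (hA.trans h1)
  · intro hno K hK hle
    obtain ⟨C, D, hs, rfl⟩ := (isStandardProductSubcomplex_iff K).1 hK
    have key : ∀ C D : Γ.Subgraph, IsStandardPair C D → A ≤ C → B ≤ D → A = C ∧ B = D := by
      intro C D hs h1 h2
      by_contra hne
      exact hno ⟨C, D, hs, h1, h2, not_and_or.1 hne⟩
    rcases (boxProd_le_iff h hs.1).1 hle with ⟨h1, h2⟩ | ⟨h1, h2⟩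
    · obtain ⟨rfl, rfl⟩ := key C D hs h1 h2
      exact le_rfl
    · obtain ⟨rfl, rfl⟩ := key D C hs.symm h1 h2
      rw [boxProd_comm]

/-! ### Paths, components and tails in subgraphs -/

namespace Subgraph

/-- Two vertices are joined by an edge of the subgraph. -/
def Adj (A : Γ.Subgraph) (x y : Γ.V) : Prop := ∃ d ∈ A.darts, Γ.src d = x ∧ Γ.tgt d = y

theorem Adj.symm {x y : Γ.V} (h : A.Adj x y) : A.Adj y x := by
  obtain ⟨d, hd, rfl, rfl⟩ := h
  exact ⟨Γ.rev d, A.rev_mem d hd, rfl, by simp [tgt, Γ.rev_rev]⟩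

theorem tgt_mem (A : Γ.Subgraph) {d : Γ.D} (hd : d ∈ A.darts) : Γ.tgt d ∈ A.verts :=
  A.src_mem _ (A.rev_mem d hd)

theorem reflTransGen_adj_symm {x y : Γ.V} (h : Relation.ReflTransGen A.Adj x y) :
    Relation.ReflTransGen A.Adj y x := by
  induction h with
  | refl => exact .refl
  | tail _ h ih => exact .head h.symm ih

theorem reflTransGen_adj_mono (hle : A ≤ B) {x y : Γ.V} (h : Relation.ReflTransGen A.Adj x y) :
    Relation.ReflTransGen B.Adj x y := by
  induction h with
  | refl => exact .refl
  | tail _ h ih =>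
    obtain ⟨d, hd, h⟩ := h
    exact ih.tail ⟨d, hle.2 hd, h⟩

/-- A subgraph is connected as soon as all its vertices can be reached from one of them. -/
theorem connected_coe {x₀ : Γ.V} (hx₀ : x₀ ∈ A.verts)
    (h : ∀ x ∈ A.verts, Relation.ReflTransGen A.Adj x₀ x) : A.coe.Connected := by
  have key : ∀ {x y : Γ.V} (hx : x ∈ A.verts) (hy : y ∈ A.verts),
      Relation.ReflTransGen A.Adj x y →
      Relation.ReflTransGen A.coe.Adj (⟨x, hx⟩ : A.verts) (⟨y, hy⟩ : A.verts) := by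
    intro x y hx hy hxy
    induction hxy with
    | refl => exact .refl
    | tail _ hbc ih =>
      obtain ⟨d, hd, rfl, rfl⟩ := hbc
      exact (ih (A.src_mem d hd)).tail ⟨⟨d, hd⟩, rfl, rfl⟩
  refine ⟨⟨⟨x₀, hx₀⟩⟩, ?_⟩
  rintro ⟨x, hx⟩ ⟨y, hy⟩
  exact key hx hy ((reflTransGen_adj_symm (h x hx)).trans (h y hy))

theorem reflTransGen_adj_of_connected (h : A.coe.Connected) {x y : Γ.V} (hx : x ∈ A.verts)
    (hy : y ∈ A.verts) : Relation.ReflTransGen A.Adj x y := by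
  refine Relation.ReflTransGen.lift (Subtype.val : A.verts → Γ.V) ?_ _ _ (h.2 ⟨x, hx⟩ ⟨y, hy⟩)
  rintro _ _ ⟨d, rfl, rfl⟩
  exact ⟨d.1, d.2, rfl, rfl⟩

/-- The union of two subgraphs. -/
def union (A B : Γ.Subgraph) : Γ.Subgraph where
  verts := A.verts ∪ B.verts
  darts := A.darts ∪ B.darts
  src_mem d := Or.imp (A.src_mem d) (B.src_mem d)
  rev_mem d := Or.imp (A.rev_mem d) (B.rev_mem d)

theorem le_union_left (A B : Γ.Subgraph) : A ≤ A.union B := ⟨fun _ => Or.inl, fun _ => Or.inl⟩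

theorem le_union_right (A B : Γ.Subgraph) : B ≤ A.union B := ⟨fun _ => Or.inr, fun _ => Or.inr⟩

theorem connected_union (hA : A.coe.Connected) (hB : B.coe.Connected) {x : Γ.V}
    (hxA : x ∈ A.verts) (hxB : x ∈ B.verts) : (A.union B).coe.Connected := by
  refine connected_coe (x₀ := x) (Or.inl hxA) ?_
  rintro y (hy | hy)
  · exact reflTransGen_adj_mono (le_union_left A B) (reflTransGen_adj_of_connected hA hxA hy)
  · exact reflTransGen_adj_mono (le_union_right A B) (reflTransGen_adj_of_connected hB hxB hy)

/-- The subgraph consisting of the edge of `d` and its endpoints. -/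
def edge (d : Γ.D) : Γ.Subgraph where
  verts := {Γ.src d, Γ.tgt d}
  darts := {d, Γ.rev d}
  src_mem := by
    rintro _ (rfl | rfl)
    · exact Or.inl rfl
    · exact Or.inr rfl
  rev_mem := by
    rintro _ (rfl | rfl)
    · exact Or.inr rfl
    · exact Or.inl (Γ.rev_rev d)

theorem connected_edge (d : Γ.D) : (edge d).coe.Connected := by
  refine connected_coe (x₀ := Γ.src d) (Or.inl rfl) ?_
  rintro _ (rfl | rfl)
  · exact .refl
  · exact .single ⟨d, Or.inl rfl, rfl, rfl⟩

/-- The connected component of the vertex `x` in a subgraph. -/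
def component (A : Γ.Subgraph) (x : Γ.V) : Γ.Subgraph where
  verts := {y | y ∈ A.verts ∧ Relation.ReflTransGen A.Adj x y}
  darts := {d | d ∈ A.darts ∧ Relation.ReflTransGen A.Adj x (Γ.src d)}
  src_mem d h := ⟨A.src_mem d h.1, h.2⟩
  rev_mem d h := ⟨A.rev_mem d h.1, h.2.tail ⟨d, h.1, rfl, rfl⟩⟩

theorem component_le (A : Γ.Subgraph) (x : Γ.V) : A.component x ≤ A :=
  ⟨fun _ h => h.1, fun _ h => h.1⟩

theorem connected_component {x : Γ.V} (hx : x ∈ A.verts) : (A.component x).coe.Connected := by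
  refine connected_coe (x₀ := x) ⟨hx, .refl⟩ ?_
  rintro y ⟨-, hy⟩
  induction hy with
  | refl => exact .refl
  | tail h₁ h₂ ih =>
    obtain ⟨d, hd, rfl, rfl⟩ := h₂
    exact ih.tail ⟨d, ⟨hd, h₁⟩, rfl, rfl⟩

/-- The vertex `x` has valency at least two in the subgraph `A`. -/
def IsBranching (A : Γ.Subgraph) (x : Γ.V) : Prop :=
  ∃ d ∈ A.darts, ∃ e ∈ A.darts, d ≠ e ∧ Γ.src d = x ∧ Γ.src e = x

/-- Unlike leaflessness, branching at a vertex passes to larger subgraphs, so unions can be checked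
one vertex at a time. -/
theorem IsBranching.mono {x : Γ.V} (h : A.IsBranching x) (hle : A ≤ B) : B.IsBranching x := by
  obtain ⟨d, hd, e, he, h⟩ := h
  exact ⟨d, hle.2 hd, e, hle.2 he, h⟩

theorem exists_dart (h : A.coe.NoIsolatedVertex) {x : Γ.V} (hx : x ∈ A.verts) :
    ∃ d ∈ A.darts, Γ.src d = x := by
  obtain ⟨d, hd⟩ := h ⟨x, hx⟩
  exact ⟨d.1, d.2, congrArg Subtype.val hd⟩

theorem isBranching (h : A.coe.Leafless) (h' : A.coe.NoIsolatedVertex) {x : Γ.V}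
    (hx : x ∈ A.verts) : A.IsBranching x := by
  obtain ⟨d, hd⟩ := h' ⟨x, hx⟩
  by_contra hno
  refine h ⟨x, hx⟩ ⟨d, hd, fun e he => ?_⟩
  by_contra hne
  exact hno ⟨e.1, e.2, d.1, d.2, fun k => hne (Subtype.ext k), congrArg Subtype.val he,
    congrArg Subtype.val hd⟩

theorem leafless_coe (h : ∀ x ∈ A.verts, A.IsBranching x) : A.coe.Leafless := by
  rintro ⟨x, hx⟩ ⟨d, -, huniq⟩
  obtain ⟨e, he, e', he', hne, hs, hs'⟩ := h x hx
  have h1 := huniq ⟨e, he⟩ (Subtype.ext hs)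
  have h2 := huniq ⟨e', he'⟩ (Subtype.ext hs')
  exact hne (congrArg Subtype.val (h1.trans h2.symm))

/-- A component contains every half-edge of `A` at each of its vertices. -/
theorem IsBranching.component {x y : Γ.V} (h : A.IsBranching y)
    (hy : y ∈ (A.component x).verts) : (A.component x).IsBranching y := by
  obtain ⟨d, hd, e, he, hne, rfl, hs⟩ := h
  exact ⟨d, ⟨hd, hy.2⟩, e, ⟨he, by rw [hs]; exact hy.2⟩, hne, rfl, hs⟩

/-- The vertices that can be reached from `A` by a path of length at most `n` off `B`. -/
def ball (A B : Γ.Subgraph) : ℕ → Set Γ.V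
  | 0 => A.verts
  | n + 1 => ball A B n ∪ {y | y ∉ B.verts ∧ ∃ d, Γ.src d ∈ ball A B n ∧ Γ.tgt d = y}

theorem disjoint_ball (h : A.IsDisjoint B) (n : ℕ) : Disjoint (ball A B n) B.verts := by
  induction n with
  | zero => exact h
  | succ n ih =>
    refine Set.disjoint_left.2 ?_
    rintro y (hy | hy)
    · exact Set.disjoint_left.1 ih hy
    · exact hy.1

/-- In a connected graph every vertex can be reached from `A` off `B` or from `B` off `A`. -/
theorem exists_mem_ball (hΓ : Γ.Connected) (hA : A.verts.Nonempty) (x : Γ.V) :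
    ∃ n, x ∈ ball A B n ∨ x ∈ ball B A n := by
  obtain ⟨a, ha⟩ := hA
  induction hΓ.2 a x with
  | refl => exact ⟨0, Or.inl ha⟩
  | @tail y z _ h ih =>
    obtain ⟨d, rfl, rfl⟩ := h
    obtain ⟨n, hn | hn⟩ := ih
    -- When the path runs into the other subgraph, the count restarts there at radius `0`.
    · by_cases hz : Γ.tgt d ∈ B.verts
      · exact ⟨0, Or.inr hz⟩
      · exact ⟨n + 1, Or.inl (Or.inr ⟨hz, d, hn, rfl⟩)⟩
    · by_cases hz : Γ.tgt d ∈ A.verts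
      · exact ⟨0, Or.inl hz⟩
      · exact ⟨n + 1, Or.inr (Or.inr ⟨hz, d, hn, rfl⟩)⟩

/-- A connected leafless subgraph `A` can be joined to any vertex `x` of `ball A B n` by a tail, such
that `x` is the only possible leaf. -/
theorem exists_tail (hA : A.coe.Connected) (hA' : A.coe.NoIsolatedVertex) (lA : A.coe.Leafless)
    (n : ℕ) : ∀ x ∈ ball A B n, ∃ P : Γ.Subgraph, A ≤ P ∧ P.coe.Connected ∧ x ∈ P.verts ∧
      P.verts ⊆ ball A B n ∧ ∀ y ∈ P.verts, y ≠ x → P.IsBranching y := by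
  induction n with
  | zero =>
    intro x hx
    exact ⟨A, le_rfl, hA, hx, subset_rfl, fun y hy _ => isBranching lA hA' hy⟩
  | succ n ih =>
    intro x hx
    by_cases hxn : x ∈ ball A B n
    · obtain ⟨P, h1, h2, h3, h4, h5⟩ := ih x hxn
      exact ⟨P, h1, h2, h3, h4.trans Set.subset_union_left, h5⟩
    obtain ⟨-, d, hd, rfl⟩ := hx.resolve_left hxn
    obtain ⟨P, h1, h2, h3, h4, h5⟩ := ih _ hd
    -- The new endpoint lies outside the smaller ball, so `d` is a new half-edge at its source.
    -- Together with an old one it makes the only possible leaf of `P` branch.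
    have hdP : d ∉ P.darts := fun h => hxn (h4 (P.tgt_mem h))
    have hP : P.coe.IsNontrivial := by
      obtain ⟨⟨y, hy⟩⟩ := hA.1
      obtain ⟨e, he, -⟩ := exists_dart hA' hy
      exact ⟨⟨e, h1.2 he⟩⟩
    refine ⟨P.union (edge d), h1.trans (le_union_left _ _),
      connected_union h2 (connected_edge d) h3 (Or.inl rfl), Or.inr (Or.inr rfl), ?_, ?_⟩
    · rintro y (hy | rfl | rfl)
      · exact Or.inl (h4 hy)
      · exact Or.inl hd
      · exact hx
    · have hsrc : (P.union (edge d)).IsBranching (Γ.src d) := by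
        obtain ⟨e, he, hes⟩ := exists_dart (h2.noIsolatedVertex hP) h3
        exact ⟨e, Or.inl he, d, Or.inr (Or.inl rfl), fun k => hdP (k ▸ he), hes, rfl⟩
      rintro y (hy | rfl | rfl) hne
      · by_cases hyd : y = Γ.src d
        · exact hyd ▸ hsrc
        · exact (h5 y hy hyd).mono (le_union_left _ _)
      · exact hsrc
      · exact absurd rfl hne

/-- Two connected leafless subgraphs `A`, `C` off `B` lie in a connected leafless subgraph off `B`
if some vertex of `C` can be reached from `A` off `B`. -/
theorem exists_connected_leafless (hAB : A.IsDisjoint B) (hCB : C.IsDisjoint B)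
    (hA : A.coe.Connected) (hA' : A.coe.NoIsolatedVertex) (lA : A.coe.Leafless)
    (hC : C.coe.Connected) (lC : ∀ x ∈ C.verts, C.IsBranching x) {n : ℕ} {x : Γ.V}
    (hx : x ∈ ball A B n) (hxC : x ∈ C.verts) :
    ∃ P : Γ.Subgraph, A ≤ P ∧ C ≤ P ∧ P.IsDisjoint B ∧ P.coe.Connected ∧ P.coe.Leafless := by
  obtain ⟨P, h1, h2, h3, h4, h5⟩ := exists_tail hA hA' lA n x hx
  refine ⟨P.union C, h1.trans (le_union_left _ _), le_union_right _ _, ?_,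
    connected_union h2 hC h3 hxC, leafless_coe ?_⟩
  · exact Set.disjoint_union_left.2 ⟨(disjoint_ball hAB n).mono_left h4, hCB⟩
  · rintro y (hy | hy)
    -- The possible leaf `x` of the tail lies in `C`, where it branches.
    · by_cases hyx : y = x
      · exact (lC y (hyx ▸ hxC)).mono (le_union_right _ _)
      · exact (h5 y hy hyx).mono (le_union_left _ _)
    · exact (lC y hy).mono (le_union_right _ _)

end Subgraph

/-! ### Disconnected enlargements and maximality -/

open Subgraph

theorem IsStandardPair.isLeaflessPair (h : IsStandardPair A B) : IsLeaflessPair A B :=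
  ⟨h.1.1, h.2.1, h.1.2.1.noIsolatedVertex h.1.2.2.1, h.2.2,
    h.1.2.2.2.1.noIsolatedVertex h.1.2.2.2.2⟩

theorem Enlarges.symm {A' B' : Γ.Subgraph} (h : Enlarges A' B' A B) : Enlarges B' A' B A :=
  ⟨h.2.1, h.1, h.2.2.symm⟩

theorem isNontrivial_coe_of_le (h : A ≤ B) (hA : A.coe.IsNontrivial) : B.coe.IsNontrivial := by
  obtain ⟨d⟩ := hA
  exact ⟨⟨d.1, h.2 d.2⟩⟩

/-- A standard pair `(A, B)` can be enlarged to another standard pair if `A` is properly contained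
in a leafless subgraph off `B`. -/
theorem IsStandardPair.exists_enlarges_of_left (hΓ : Γ.Connected) (h : IsStandardPair A B)
    {A' : Γ.Subgraph} (hA'B : A'.IsDisjoint B) (lA' : A'.coe.Leafless)
    (iA' : A'.coe.NoIsolatedVertex) (hle : A ≤ A') (hne : A ≠ A') :
    ∃ P Q : Γ.Subgraph, IsStandardPair P Q ∧ Enlarges P Q A B := by
  obtain ⟨⟨hAB, hA, nA, hB, nB⟩, lA, lB⟩ := h
  have iA := hA.noIsolatedVertex nA
  have iB := hB.noIsolatedVertex nB
  -- Without isolated vertices in `A'`, equality of darts would force equality of vertices.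
  obtain ⟨d, hdA', hdA⟩ : ∃ d ∈ A'.darts, d ∉ A.darts := by
    by_contra! hcon
    refine hne (le_antisymm hle ⟨fun x hx => ?_, hcon⟩)
    obtain ⟨d, hd, rfl⟩ := exists_dart iA' hx
    exact A.src_mem d (hcon d hd)
  have hsrc := A'.src_mem d hdA'
  have hdC : d ∈ (A'.component (Γ.src d)).darts := ⟨hdA', .refl⟩
  have hC := connected_component hsrc
  have lC : ∀ x ∈ (A'.component (Γ.src d)).verts, (A'.component (Γ.src d)).IsBranching x :=
    fun x hx => (isBranching lA' iA' hx.1).component hx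
  have hCB : (A'.component (Γ.src d)).IsDisjoint B := hA'B.mono_left (component_le _ _).1
  generalize A'.component (Γ.src d) = C at hdC hC lC hCB
  have hx := C.src_mem d hdC
  have left : ∀ {n : ℕ} {x : Γ.V}, x ∈ ball A B n → x ∈ C.verts →
      ∃ P Q : Γ.Subgraph, IsStandardPair P Q ∧ Enlarges P Q A B := by
    intro n x hxn hxC
    obtain ⟨P, hAP, hCP, hPB, hP, lP⟩ :=
      exists_connected_leafless hAB hCB hA iA lA hC lC hxn hxC
    exact ⟨P, B, ⟨⟨hPB, hP, isNontrivial_coe_of_le hAP nA, hB, nB⟩, lP, lB⟩, hAP, le_rfl,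
      Or.inl fun e => hdA (e ▸ hCP.2 hdC)⟩
  -- A component disjoint from `A` may be reachable only from `B`. Then `B` absorbs it, and the
  -- enlargement is proper because `C` is disjoint from `B`.
  by_cases hCA : C.IsDisjoint A
  · obtain ⟨n, hn | hn⟩ := exists_mem_ball (B := B) hΓ ⟨_, hA.1.some.2⟩ (Γ.src d)
    · exact left hn hx
    · obtain ⟨P, hBP, hCP, hPA, hP, lP⟩ :=
        exists_connected_leafless hAB.symm hCA hB iB lB hC lC hn hx
      exact ⟨A, P, ⟨⟨hPA.symm, hA, nA, hP, isNontrivial_coe_of_le hBP nB⟩, lA, lP⟩, le_rfl, hBP,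
        Or.inr fun e => Set.disjoint_left.1 hCB hx (e ▸ hCP.1 hx)⟩
  · obtain ⟨x, hxC, hxA⟩ := Set.not_disjoint_iff.1 hCA
    exact left (n := 0) hxA hxC

/-- One proper inclusion suffices: if `A` grows, the other member can be shrunk back to `B`, keeping
the pair disjoint; if `B` grows, the roles are exchanged. -/
theorem IsStandardPair.exists_enlarges_iff (hΓ : Γ.Connected) (h : IsStandardPair A B) :
    (∃ A' B' : Γ.Subgraph, IsStandardPair A' B' ∧ Enlarges A' B' A B) ↔
      ∃ A' B' : Γ.Subgraph, IsLeaflessPair A' B' ∧ Enlarges A' B' A B := by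
  constructor
  · rintro ⟨A', B', hs, he⟩
    exact ⟨A', B', hs.isLeaflessPair, he⟩
  · rintro ⟨A', B', ⟨hd, lA, iA, lB, iB⟩, hA, hB, hne | hne⟩
    · exact h.exists_enlarges_of_left hΓ (hd.mono_right hB.1) lA iA hA hne
    · obtain ⟨P, Q, hs, he⟩ :=
        h.symm.exists_enlarges_of_left hΓ (hd.symm.mono_right hA.1) lB iB hB hne
      exact ⟨Q, P, hs.symm, he.symm⟩

theorem isMaximalProductSubcomplex_boxProd_iff_leaflessPair (hΓ : Γ.Connected)
    (h : IsDisjointPair A B) :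
    IsMaximalProductSubcomplex (boxProd A B) ↔ IsStandardProductSubcomplex (boxProd A B) ∧
      ¬ ∃ A' B' : Γ.Subgraph, IsLeaflessPair A' B' ∧ Enlarges A' B' A B := by
  rw [isMaximalProductSubcomplex_boxProd_iff h]
  refine and_congr_right fun hs => not_congr ?_
  exact IsStandardPair.exists_enlarges_iff hΓ
    ⟨h, (isStandardProductSubcomplex_boxProd_iff h).1 hs⟩

end SerreGraph

theorem mainTheorem8 (Γ : SerreGraph.{u}) (hΓ : Γ.Connected) :
    -- product subcomplexes and standard product subcomplexes
    (∀ K : (UD2 Γ).Subcomplex,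
      IsProductSubcomplex K ↔ ∃ A B : Γ.Subgraph, IsDisjointPair A B ∧ K = boxProd A B) ∧
    (∀ K : (UD2 Γ).Subcomplex,
      IsStandardProductSubcomplex K ↔
        ∃ A B : Γ.Subgraph, IsStandardPair A B ∧ K = boxProd A B) ∧
    (∀ A B : Γ.Subgraph, IsDisjointPair A B →
      (IsStandardProductSubcomplex (boxProd A B) ↔ A.coe.Leafless ∧ B.coe.Leafless)) ∧
    -- all of them are embedded
    (∀ (G H : SerreGraph.{v}) (φ : Hom (SquareComplex.prod G H) (UD2 Γ)),
      G.Connected → G.IsNontrivial → H.Connected → H.IsNontrivial →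
      IsProductStructure φ → φ.Injective) ∧
    -- inclusion; in particular the pair is determined by the subcomplex up to swapping
    (∀ A B C D : Γ.Subgraph, IsDisjointPair A B → IsDisjointPair C D →
      (boxProd A B ≤ boxProd C D ↔ (A ≤ C ∧ B ≤ D) ∨ (A ≤ D ∧ B ≤ C))) ∧
    (∀ A B C D : Γ.Subgraph, IsDisjointPair A B → IsDisjointPair C D →
      (boxProd A B = boxProd C D ↔ (A = C ∧ B = D) ∨ (A = D ∧ B = C))) ∧
    -- maximality, in terms of connected and of possibly disconnected larger pairs
    (∀ A B : Γ.Subgraph, IsDisjointPair A B →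
      (IsMaximalProductSubcomplex (boxProd A B) ↔
        IsStandardProductSubcomplex (boxProd A B) ∧
          ¬ ∃ A' B' : Γ.Subgraph, IsStandardPair A' B' ∧ Enlarges A' B' A B) ∧
      (IsMaximalProductSubcomplex (boxProd A B) ↔
        IsStandardProductSubcomplex (boxProd A B) ∧
          ¬ ∃ A' B' : Γ.Subgraph, IsLeaflessPair A' B' ∧ Enlarges A' B' A B)) := by
  exact ⟨isProductSubcomplex_iff, isStandardProductSubcomplex_iff,
    fun _ _ => isStandardProductSubcomplex_boxProd_iff,
    fun _ _ => injective_of_isProductStructure,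
    fun _ _ _ _ => boxProd_le_iff, fun _ _ _ _ => boxProd_eq_iff,
    fun _ _ h => ⟨isMaximalProductSubcomplex_boxProd_iff h,
      isMaximalProductSubcomplex_boxProd_iff_leaflessPair hΓ h⟩⟩
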